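/- Let $1\le q\le\infty$ and let $V\in L^q[0,1]$ be a real-valued potential. Consider the Dirichlet eigenvalue problem $$-\phi''+V\phi=\lambda\phi\ \text{ a.e. on } [0,1],\qquad \phi(0)=\phi(1)=0,$$ where $\phi$ is real-valued and differentiable on $[0,1]$ with absolutely continuous derivative $\phi'$; a real number $\lambda$ is an eigenvalue if there is a solution $\phi\not\equiv0$, and its multiplicity is the dimension of the space of solutions. Then every eigenvalue has finite multiplicity, and, with $\lambda_1\le\lambda_2\le\cdots$ denoting the eigenvalues counted with multiplicity, the heat trace $$\mathrm{Tr}(e^{-t\mathscr T_V})=\sum_{n\ge1}e^{-t\lambda_n}$$ of the corresponding Schrödinger operator $\mathscr T_V$ converges for every $t>0$ and satisfies $$\mathrm{Tr}(e^{-t\mathscr T_V})=\frac1{2\sqrt{\pi t}}-\frac12+O(\sqrt t)\qquad\text{as } t\to0^+,$$ where the constant in the $O$-term may depend on $V$. -/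

import Mathlib

open Set Filter Topology MeasureTheory Asymptotics
open scoped ENNReal

/-- `φ` solves the Dirichlet problem `-φ'' + V φ = μ φ`, `φ 0 = φ 1 = 0` on `[0,1]` in the standard
(Carathéodory) sense: `φ` has a derivative `ψ` on `[0,1]` (one-sided at the endpoints) which is
absolutely continuous, and the equation holds almost everywhere. Functions on `[0,1]` are
represented by functions on `ℝ` that vanish outside `[0,1]`. -/
def IsDirichletSolution (V : ℝ → ℝ) (μ : ℝ) (φ : ℝ → ℝ) : Prop :=
  (∀ x ∉ Icc (0 : ℝ) 1, φ x = 0) ∧ φ 0 = 0 ∧ φ 1 = 0 ∧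
  ∃ ψ ψ' : ℝ → ℝ,
    (∀ x ∈ Icc (0 : ℝ) 1, HasDerivWithinAt φ (ψ x) (Icc 0 1) x) ∧
    AbsolutelyContinuousOnInterval ψ 0 1 ∧
    (∀ᵐ x ∂(volume.restrict (Icc (0 : ℝ) 1)),
      HasDerivAt ψ (ψ' x) x ∧ -ψ' x + V x * φ x = μ * φ x)

/-- The space of solutions of the Dirichlet problem for the spectral parameter `μ`. -/
def dirichletEigenspace (V : ℝ → ℝ) (μ : ℝ) : Submodule ℝ (ℝ → ℝ) where
  carrier := {φ | IsDirichletSolution V μ φ}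
  zero_mem' := by
    refine ⟨fun _ _ => rfl, rfl, rfl, 0, 0, fun x _ => hasDerivWithinAt_const x _ 0, ?_, ?_⟩
    · exact (LipschitzWith.const (0 : ℝ)).lipschitzOnWith.absolutelyContinuousOnInterval
    · exact Eventually.of_forall fun x => ⟨hasDerivAt_const x 0, by simp⟩
  add_mem' := by
    rintro φ₁ φ₂ ⟨ho₁, hz₁, he₁, ψ₁, χ₁, hd₁, ha₁, hs₁⟩ ⟨ho₂, hz₂, he₂, ψ₂, χ₂, hd₂, ha₂, hs₂⟩
    refine ⟨fun x hx => by simp [ho₁ x hx, ho₂ x hx], by simp [hz₁, hz₂], by simp [he₁, he₂],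
      ψ₁ + ψ₂, χ₁ + χ₂, fun x hx => (hd₁ x hx).add (hd₂ x hx), ha₁.add ha₂, ?_⟩
    filter_upwards [hs₁, hs₂] with x h₁ h₂
    refine ⟨h₁.1.add h₂.1, ?_⟩
    simp only [Pi.add_apply]
    linear_combination h₁.2 + h₂.2
  smul_mem' := by
    rintro c φ ⟨ho, hz, he, ψ, χ, hd, ha, hs⟩
    refine ⟨fun x hx => by simp [ho x hx], by simp [hz], by simp [he],
      c • ψ, c • χ, fun x hx => (hd x hx).const_smul c, ha.const_smul c, ?_⟩
    filter_upwards [hs] with x h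
    refine ⟨h.1.const_smul c, ?_⟩
    simp only [Pi.smul_apply, smul_eq_mul]
    linear_combination c * h.2

/-- The eigenvalues of the Dirichlet Schrödinger operator `-d²/dx² + V` on `[0,1]`. -/
def dirichletEigenvalues (V : ℝ → ℝ) : Set ℝ :=
  {μ | dirichletEigenspace V μ ≠ ⊥}

/-- The term of the eigenvalue `μ` in the heat trace at time `t`: `exp (-t μ)` times the
multiplicity of `μ`. -/
noncomputable def heatTerm (V : ℝ → ℝ) (t : ℝ) (μ : dirichletEigenvalues V) : ℝ :=
  Module.finrank ℝ (dirichletEigenspace V μ) * Real.exp (-t * μ)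

/-- The heat trace: the sum of `exp (-t λ)` over all Dirichlet eigenvalues `λ`, counted with
multiplicity. -/
noncomputable def heatTrace (V : ℝ → ℝ) (t : ℝ) : ℝ :=
  ∑' μ : dirichletEigenvalues V, heatTerm V t μ

/-! Write a solution with `φ 0 = 0` as `φ = r sin θ`, `φ' = r cos θ`. The Prüfer angle obeys the
first-order equation `θ' = 1 + (μ - 1 - V) sin² θ`, which makes sense for `V ∈ L¹`. Solutions with
`φ 0 = 0` form a line, so `μ` is an eigenvalue exactly when `sin (θ 1) = 0`, and it is then simple
(`mem_dirichletEigenvalues_iff`, `finrank_dirichletEigenspace`).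

As a function of `μ`, the endpoint angle `θ 1` is continuous, strictly increasing, positive, below
`π` for very negative `μ`, and unbounded above. Hence each `(n + 1) π` is attained exactly once, and
this enumerates the spectrum.

For `μ = ρ²` the angle of `(cos θ, ρ sin θ)` moves with speed `ρ` up to an error `|V| / ρ`
(`abs_rescaleAngle_sub_le`), and it agrees with `θ` at multiples of `π`. So `(n + 1) π = ρ +
O(1/ρ)`, and the eigenvalues are `π² (n + 1)² + O(1)`.

A bounded shift of the eigenvalues changes each heat term by a relative error `O(t)`, hence the
trace by `O(t) · O(1/√t) = O(√t)`. Poisson summation evaluates the trace for `V = 0`. -/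

/-! ### Calculus of absolutely continuous functions on `[0,1]` -/

/-- `f` is absolutely continuous on `[0,1]` with derivative `g` almost everywhere. -/
structure HasACDeriv (f g : ℝ → ℝ) : Prop where
  ac : AbsolutelyContinuousOnInterval f 0 1
  ae_hasDerivAt : ∀ᵐ x ∂(volume.restrict (Icc (0 : ℝ) 1)), HasDerivAt f (g x) x

theorem AbsolutelyContinuousOnInterval.lipschitz_comp {f F : ℝ → ℝ} {a b : ℝ} {s : Set ℝ}
    {K : NNReal} (hf : AbsolutelyContinuousOnInterval f a b) (hF : LipschitzOnWith K F s)
    (hs : MapsTo f (uIcc a b) s) : AbsolutelyContinuousOnInterval (fun x => F (f x)) a b := by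
  rw [absolutelyContinuousOnInterval_iff] at hf ⊢
  intro ε hε
  obtain ⟨δ, hδ, h⟩ := hf (ε / (K + 1)) (by positivity)
  refine ⟨δ, hδ, fun E hE hlt => ?_⟩
  have h1 := h E hE hlt
  calc ∑ i ∈ Finset.range E.1, dist (F (f (E.2 i).1)) (F (f (E.2 i).2))
      ≤ ∑ i ∈ Finset.range E.1, (K + 1 : ℝ) * dist (f (E.2 i).1) (f (E.2 i).2) := by
        refine Finset.sum_le_sum fun i hi => ?_
        refine (hF.dist_le_mul _ (hs (hE.1 i hi).1) _ (hs (hE.1 i hi).2)).trans ?_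
        gcongr
        simp
    _ = (K + 1 : ℝ) * ∑ i ∈ Finset.range E.1, dist (f (E.2 i).1) (f (E.2 i).2) := by
        rw [Finset.mul_sum]
    _ < (K + 1 : ℝ) * (ε / (K + 1)) := by gcongr
    _ = ε := by field_simp

theorem ae_restrict_unitInterval_iff {p : ℝ → Prop} :
    (∀ᵐ x ∂(volume.restrict (Icc (0 : ℝ) 1)), p x) ↔ ∀ᵐ x, x ∈ uIcc (0 : ℝ) 1 → p x := by
  rw [ae_restrict_iff' measurableSet_Icc, uIcc_of_le zero_le_one]

namespace HasACDeriv

variable {f g f₁ g₁ f₂ g₂ : ℝ → ℝ}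

theorem continuousOn (h : HasACDeriv f g) : ContinuousOn f (uIcc 0 1) := h.ac.continuousOn

theorem congr_deriv (h : HasACDeriv f g)
    (hg : ∀ᵐ x ∂(volume.restrict (Icc (0 : ℝ) 1)), g x = g₁ x) : HasACDeriv f g₁ := by
  refine ⟨h.ac, ?_⟩
  filter_upwards [h.ae_hasDerivAt, hg] with x h1 h2
  rwa [← h2]

theorem congr_deriv' (h : HasACDeriv f g) (hg : ∀ x, g x = g₁ x) : HasACDeriv f g₁ :=
  h.congr_deriv (Eventually.of_forall hg)

theorem deriv_ae_eq (h : HasACDeriv f g) :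
    deriv f =ᵐ[volume.restrict (Icc (0 : ℝ) 1)] g := by
  filter_upwards [h.ae_hasDerivAt] with x hx using hx.deriv

theorem intervalIntegrable (h : HasACDeriv f g) : IntervalIntegrable g volume 0 1 := by
  refine h.ac.intervalIntegrable_deriv.congr_ae ?_
  rw [uIoc_of_le zero_le_one, Measure.restrict_congr_set Ioc_ae_eq_Icc]
  exact h.deriv_ae_eq

theorem integral_eq (h : HasACDeriv f g) {x : ℝ} (hx : x ∈ Icc (0 : ℝ) 1) :
    ∫ s in (0 : ℝ)..x, g s = f x - f 0 := by
  have hsub : uIcc 0 x ⊆ uIcc (0 : ℝ) 1 := by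
    rw [uIcc_of_le hx.1, uIcc_of_le zero_le_one]; exact Icc_subset_Icc_right hx.2
  rw [← (h.ac.mono hsub).integral_deriv_eq_sub]
  refine intervalIntegral.integral_congr_ae ?_
  filter_upwards [ae_restrict_unitInterval_iff.1 h.ae_hasDerivAt] with y hy hy'
  exact (hy (hsub (uIoc_subset_uIcc hy'))).deriv.symm

theorem of_integral (hg : IntervalIntegrable g volume 0 1) :
    HasACDeriv (fun x => ∫ s in (0 : ℝ)..x, g s) g := by
  refine ⟨hg.absolutelyContinuousOnInterval_intervalIntegral (by simp), ?_⟩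
  rw [ae_restrict_unitInterval_iff]
  filter_upwards [hg.ae_hasDerivAt_integral] with x hx hx'
  exact hx hx' 0 (by simp)

theorem add (h₁ : HasACDeriv f₁ g₁) (h₂ : HasACDeriv f₂ g₂) :
    HasACDeriv (fun x => f₁ x + f₂ x) (fun x => g₁ x + g₂ x) := by
  refine ⟨h₁.ac.add h₂.ac, ?_⟩
  filter_upwards [h₁.ae_hasDerivAt, h₂.ae_hasDerivAt] with x hx hx' using hx.add hx'

theorem sub (h₁ : HasACDeriv f₁ g₁) (h₂ : HasACDeriv f₂ g₂) :
    HasACDeriv (fun x => f₁ x - f₂ x) (fun x => g₁ x - g₂ x) := by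
  refine ⟨h₁.ac.sub h₂.ac, ?_⟩
  filter_upwards [h₁.ae_hasDerivAt, h₂.ae_hasDerivAt] with x hx hx' using hx.sub hx'

theorem mul (h₁ : HasACDeriv f₁ g₁) (h₂ : HasACDeriv f₂ g₂) :
    HasACDeriv (fun x => f₁ x * f₂ x) (fun x => g₁ x * f₂ x + f₁ x * g₂ x) := by
  refine ⟨h₁.ac.mul h₂.ac, ?_⟩
  filter_upwards [h₁.ae_hasDerivAt, h₂.ae_hasDerivAt] with x hx hx' using hx.mul hx'

/-- The range of `f` on `[0,1]` lies in a compact interval, where the `C¹` function `F` is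
Lipschitz; Lipschitz maps preserve absolute continuity. -/
theorem comp {F F' : ℝ → ℝ} (h : HasACDeriv f g) (hF : ∀ y, HasDerivAt F (F' y) y)
    (hF' : Continuous F') : HasACDeriv (fun x => F (f x)) (fun x => F' (f x) * g x) := by
  obtain ⟨C, hC⟩ := h.ac.exists_bound
  have hF1 : ContDiff ℝ 1 F := by
    rw [contDiff_one_iff_deriv]
    refine ⟨fun y => (hF y).differentiableAt, ?_⟩
    rwa [show deriv F = F' from funext fun y => (hF y).deriv]
  obtain ⟨K, hK⟩ := (hF1.contDiffOn (s := Icc (-C) C)).exists_lipschitzOnWith (by decide)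
    (convex_Icc _ _) isCompact_Icc
  refine ⟨h.ac.lipschitz_comp hK fun x hx => abs_le.1 (hC x hx), ?_⟩
  filter_upwards [h.ae_hasDerivAt] with x hx using (hF (f x)).comp x hx

theorem of_hasDerivWithinAt
    (h : ∀ x ∈ Icc (0 : ℝ) 1, HasDerivWithinAt f (g x) (Icc 0 1) x)
    (hg : ContinuousOn g (Icc 0 1)) : HasACDeriv f g := by
  constructor
  · obtain ⟨C, hC⟩ := isCompact_Icc.exists_bound_of_continuousOn hg
    have hL : LipschitzOnWith (Real.toNNReal C) f (uIcc 0 1) := by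
      rw [uIcc_of_le zero_le_one]
      refine (convex_Icc (0 : ℝ) 1).lipschitzOnWith_of_nnnorm_hasDerivWithin_le h fun x hx => ?_
      rw [← NNReal.coe_le_coe]
      exact (hC x hx).trans (Real.le_coe_toNNReal C)
    exact hL.absolutelyContinuousOnInterval
  · rw [← Measure.restrict_congr_set Ioo_ae_eq_Icc, ae_restrict_iff' measurableSet_Ioo]
    exact Eventually.of_forall fun x hx =>
      (h x (Ioo_subset_Icc_self hx)).hasDerivAt (Icc_mem_nhds hx.1 hx.2)

theorem eq_of_deriv_eq_zero (h : HasACDeriv f fun _ => 0) {x : ℝ} (hx : x ∈ Icc (0 : ℝ) 1) :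
    f x = f 0 := by
  have := h.integral_eq hx
  simp at this
  linarith

/-- The variation of constants formula for the linear equation `f' = a f + b`. -/
theorem variation_of_constants {a b : ℝ → ℝ} (ha : IntervalIntegrable a volume 0 1)
    (h : HasACDeriv f fun x => a x * f x + b x) :
    HasACDeriv (fun x => f x * Real.exp (-∫ s in (0 : ℝ)..x, a s))
      (fun x => b x * Real.exp (-∫ s in (0 : ℝ)..x, a s)) := by
  have h2 := (of_integral ha).comp (F := fun y => Real.exp (-y)) (F' := fun y => -Real.exp (-y))
    (fun y => by simpa using (hasDerivAt_neg y).exp) (by fun_prop)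
  exact (h.mul h2).congr_deriv' fun x => by ring

end HasACDeriv

/-! ### Existence of the Prüfer angle -/

theorem abs_sin_sq_sub_sin_sq_le (α β : ℝ) :
    |Real.sin α ^ 2 - Real.sin β ^ 2| ≤ |α - β| := by
  have h : Real.sin α ^ 2 - Real.sin β ^ 2 = Real.sin (α - β) * Real.sin (α + β) := by
    rw [Real.sin_sub, Real.sin_add]
    nlinarith [Real.sin_sq_add_cos_sq α, Real.sin_sq_add_cos_sq β]
  rw [h, abs_mul]
  exact (mul_le_of_le_one_right (abs_nonneg _) (Real.abs_sin_le_one _)).trans Real.abs_sin_le_abs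

/-- Using `sinc` for the divided difference keeps the coefficient of `α - β` bounded and continuous
where `α = β`. The difference of two Prüfer angles thereby solves a linear equation. -/
theorem sin_sq_sub_sin_sq (α β : ℝ) :
    Real.sin α ^ 2 - Real.sin β ^ 2 = Real.sinc (α - β) * Real.sin (α + β) * (α - β) := by
  have h : Real.sin α ^ 2 - Real.sin β ^ 2 = Real.sin (α - β) * Real.sin (α + β) := by
    rw [Real.sin_sub, Real.sin_add]
    nlinarith [Real.sin_sq_add_cos_sq α, Real.sin_sq_add_cos_sq β]
  rw [h]
  rcases eq_or_ne (α - β) 0 with h0 | h0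
  · simp [h0]
  · rw [Real.sinc_of_ne_zero h0]; field_simp

section Existence

variable {U : ℝ → ℝ}

theorem IntervalIntegrable.mono_unitInterval {g : ℝ → ℝ} (hg : IntervalIntegrable g volume 0 1)
    {x : ℝ} (hx : x ∈ Icc (0 : ℝ) 1) : IntervalIntegrable g volume 0 x := by
  refine hg.mono_set ?_
  rw [uIcc_of_le hx.1, uIcc_of_le zero_le_one]; exact Icc_subset_Icc_right hx.2

theorem continuousOn_primitive_unitInterval {g : ℝ → ℝ} (hg : IntervalIntegrable g volume 0 1) :
    ContinuousOn (fun x => ∫ s in (0 : ℝ)..x, g s) (Icc 0 1) := by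
  simpa [uIcc_of_le (zero_le_one' ℝ)] using (HasACDeriv.of_integral hg).continuousOn

theorem integral_abs_mul_exp (hU : IntervalIntegrable U volume 0 1) {x : ℝ}
    (hx : x ∈ Icc (0 : ℝ) 1) :
    ∫ s in (0 : ℝ)..x, |U s| * Real.exp (2 * ∫ r in (0 : ℝ)..s, |U r|) =
      (Real.exp (2 * ∫ r in (0 : ℝ)..x, |U r|) - 1) / 2 := by
  have h := (HasACDeriv.of_integral hU.abs).comp (F := fun y => Real.exp (2 * y) / 2)
    (F' := fun y => Real.exp (2 * y))
    (fun y => by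
      have := (((hasDerivAt_id y).const_mul 2).exp).div_const 2
      simpa using this) (by fun_prop)
  have h2 := (h.congr_deriv' (fun x => mul_comm _ _)).integral_eq hx
  rw [h2]; simp; ring

/-- The integral operator of the Prüfer equation, conjugated with the weight
`exp (2 ∫ |U|)` that makes it a contraction. -/
noncomputable def pruferOperator (hU : IntervalIntegrable U volume 0 1)
    (u : C(Icc (0 : ℝ) 1, ℝ)) : C(Icc (0 : ℝ) 1, ℝ) where
  toFun x := Real.exp (-(2 * ∫ r in (0 : ℝ)..x, |U r|)) *
    ∫ s in (0 : ℝ)..x, (1 + U s * Real.sin (Real.exp (2 * ∫ r in (0 : ℝ)..s, |U r|) *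
      IccExtend zero_le_one u s) ^ 2)
  continuous_toFun := by
    have h1 := continuousOn_primitive_unitInterval hU.abs
    have h2 : IntervalIntegrable (fun s => 1 + U s * Real.sin (Real.exp
        (2 * ∫ r in (0 : ℝ)..s, |U r|) * IccExtend zero_le_one u s) ^ 2) volume 0 1 := by
      refine intervalIntegrable_const.add (hU.mul_continuousOn ?_)
      rw [uIcc_of_le zero_le_one]
      have : ContinuousOn (IccExtend zero_le_one u) (Icc (0 : ℝ) 1) :=
        u.continuous.Icc_extend'.continuousOn
      fun_prop
    have h3 := continuousOn_primitive_unitInterval h2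
    exact continuousOn_iff_continuous_domRestrict.1
      (((h1.const_mul 2).neg.rexp).mul h3)

theorem pruferOperator_apply (hU : IntervalIntegrable U volume 0 1) (u : C(Icc (0 : ℝ) 1, ℝ))
    (x : Icc (0 : ℝ) 1) :
    pruferOperator hU u x = Real.exp (-(2 * ∫ r in (0 : ℝ)..x, |U r|)) *
      ∫ s in (0 : ℝ)..x, (1 + U s * Real.sin (Real.exp (2 * ∫ r in (0 : ℝ)..s, |U r|) *
        IccExtend zero_le_one u s) ^ 2) := rfl

theorem intervalIntegrable_prufer (hU : IntervalIntegrable U volume 0 1) {θ : ℝ → ℝ}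
    (hθ : ContinuousOn θ (Icc 0 1)) :
    IntervalIntegrable (fun s => 1 + U s * Real.sin (θ s) ^ 2) volume 0 1 := by
  refine intervalIntegrable_const.add (hU.mul_continuousOn ?_)
  rw [uIcc_of_le zero_le_one]
  fun_prop

/-- Since `sin²` is 1-Lipschitz, with `A x = ∫₀ˣ |U|` the weighted difference is at most `e^{-2A}
(e^{2A} - 1) / 2 ≤ 1/2` times `dist u v`. The weight gives a contraction on all of `[0,1]` however
large `U` is. -/
theorem contractingWith_pruferOperator (hU : IntervalIntegrable U volume 0 1) :
    ContractingWith (1 / 2) (pruferOperator hU) := by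
  refine ⟨by rw [← NNReal.coe_lt_coe]; norm_num, LipschitzWith.of_dist_le_mul fun u v => ?_⟩
  rw [ContinuousMap.dist_le (by positivity)]
  rintro ⟨x, hx⟩
  have hA := continuousOn_primitive_unitInterval hU.abs
  have hc : ∀ w : C(Icc (0 : ℝ) 1, ℝ), ContinuousOn (fun s => Real.exp
      (2 * ∫ r in (0 : ℝ)..s, |U r|) * IccExtend zero_le_one w s) (Icc 0 1) := fun w => by
    have : ContinuousOn (IccExtend zero_le_one w) (Icc (0 : ℝ) 1) :=
      w.continuous.Icc_extend'.continuousOn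
    fun_prop
  have hi := fun w => (intervalIntegrable_prufer hU (hc w)).mono_unitInterval hx
  have hbound : IntervalIntegrable
      (fun s => |U s| * Real.exp (2 * ∫ r in (0 : ℝ)..s, |U r|) * dist u v) volume 0 x := by
    refine IntervalIntegrable.mono_unitInterval ?_ hx
    refine (hU.abs.mul_continuousOn ?_).mul_const _
    rw [uIcc_of_le zero_le_one]
    fun_prop
  rw [pruferOperator_apply, pruferOperator_apply, Real.dist_eq, ← mul_sub,
    ← intervalIntegral.integral_sub (hi u) (hi v), abs_mul, Real.abs_exp]
  have key : |∫ s in (0 : ℝ)..x, ((1 + U s * Real.sin (Real.exp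
      (2 * ∫ r in (0 : ℝ)..s, |U r|) * IccExtend zero_le_one u s) ^ 2) -
      (1 + U s * Real.sin (Real.exp
      (2 * ∫ r in (0 : ℝ)..s, |U r|) * IccExtend zero_le_one v s) ^ 2))| ≤
      ∫ s in (0 : ℝ)..x, |U s| * Real.exp (2 * ∫ r in (0 : ℝ)..s, |U r|) * dist u v := by
    rw [← Real.norm_eq_abs]
    refine intervalIntegral.norm_integral_le_of_norm_le hx.1 ?_ hbound
    refine Eventually.of_forall fun s _ => ?_
    rw [add_sub_add_left_eq_sub, ← mul_sub, norm_mul, mul_assoc, Real.norm_eq_abs, Real.norm_eq_abs]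
    refine mul_le_mul_of_nonneg_left ((abs_sin_sq_sub_sin_sq_le _ _).trans ?_) (abs_nonneg _)
    rw [← mul_sub, abs_mul, Real.abs_exp]
    refine mul_le_mul_of_nonneg_left ?_ (Real.exp_pos _).le
    rw [← Real.dist_eq]
    exact ContinuousMap.dist_apply_le_dist _
  refine (mul_le_mul_of_nonneg_left key (Real.exp_pos _).le).trans ?_
  rw [intervalIntegral.integral_mul_const, integral_abs_mul_exp hU hx, Real.exp_neg]
  have hE := Real.exp_pos (2 * ∫ r in (0 : ℝ)..x, |U r|)
  have hd : 0 ≤ dist u v := dist_nonneg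
  push_cast
  rw [inv_mul_le_iff₀ hE]
  nlinarith

theorem exists_pruferAngle (hU : IntervalIntegrable U volume 0 1) :
    ∃ θ : ℝ → ℝ, θ 0 = 0 ∧ HasACDeriv θ fun x => 1 + U x * Real.sin (θ x) ^ 2 := by
  obtain ⟨u, hu, -⟩ := (contractingWith_pruferOperator hU).exists_fixedPoint 0 (edist_ne_top _ _)
  have hA := continuousOn_primitive_unitInterval hU.abs
  have hc : ContinuousOn (fun s => Real.exp
      (2 * ∫ r in (0 : ℝ)..s, |U r|) * IccExtend zero_le_one u s) (Icc 0 1) := by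
    have : ContinuousOn (IccExtend zero_le_one u) (Icc (0 : ℝ) 1) :=
      u.continuous.Icc_extend'.continuousOn
    fun_prop
  have key : ∀ x ∈ Icc (0 : ℝ) 1, ∫ s in (0 : ℝ)..x, (1 + U s * Real.sin (Real.exp
      (2 * ∫ r in (0 : ℝ)..s, |U r|) * IccExtend zero_le_one u s) ^ 2) =
      Real.exp (2 * ∫ r in (0 : ℝ)..x, |U r|) * IccExtend zero_le_one u x := by
    intro x hx
    have h := congrArg (fun w : C(Icc (0 : ℝ) 1, ℝ) => w ⟨x, hx⟩) hu.eq
    rw [pruferOperator_apply] at h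
    rw [IccExtend_of_mem _ _ hx, ← h, ← mul_assoc, ← Real.exp_add]
    simp
  -- The angle is taken to be the integral itself, so absolute continuity is immediate; `key`
  -- identifies it on `[0,1]` with the argument of the sine.
  refine ⟨fun x => ∫ s in (0 : ℝ)..x, (1 + U s * Real.sin (Real.exp
      (2 * ∫ r in (0 : ℝ)..s, |U r|) * IccExtend zero_le_one u s) ^ 2), by simp, ?_⟩
  refine (HasACDeriv.of_integral (intervalIntegrable_prufer hU hc)).congr_deriv ?_
  rw [ae_restrict_iff' measurableSet_Icc]
  refine Eventually.of_forall fun x hx => ?_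
  simp only [key x hx]

end Existence

/-! ### Comparison of Prüfer angles at the right endpoint -/

/-- This serves as the comparison principle: the integrating factor is positive, so the signs of `D
0` and `b` decide the sign of `D 1`. -/
theorem HasACDeriv.apply_one_of_linear {D a b : ℝ → ℝ} (ha : IntervalIntegrable a volume 0 1)
    (h : HasACDeriv D fun x => a x * D x + b x) :
    IntervalIntegrable (fun x => b x * Real.exp (-∫ s in (0 : ℝ)..x, a s)) volume 0 1 ∧
    D 1 * Real.exp (-∫ s in (0 : ℝ)..1, a s) =
      D 0 + ∫ x in (0 : ℝ)..1, b x * Real.exp (-∫ s in (0 : ℝ)..x, a s) := by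
  have h1 := h.variation_of_constants ha
  refine ⟨h1.intervalIntegrable, ?_⟩
  have h2 := h1.integral_eq (x := 1) (by simp)
  rw [h2]
  simp

theorem abs_intervalIntegral_le_of_abs_le {a K : ℝ → ℝ} (hK : IntervalIntegrable K volume 0 1)
    (ha : ∀ x, |a x| ≤ K x) {x : ℝ} (hx : x ∈ Icc (0 : ℝ) 1) :
    |∫ s in (0 : ℝ)..x, a s| ≤ ∫ s in (0 : ℝ)..1, K s := by
  rw [← Real.norm_eq_abs]
  refine (intervalIntegral.norm_integral_le_of_norm_le hx.1
    (Eventually.of_forall fun s _ => ha s) (hK.mono_unitInterval hx)).trans ?_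
  exact intervalIntegral.integral_mono_interval le_rfl hx.1 hx.2
    (Eventually.of_forall fun s => (abs_nonneg _).trans (ha s)) hK

/-- The Prüfer angle `θ` of the solution of `-φ'' + V φ = μ φ` with `φ 0 = 0`, for which
`φ = r sin θ` and `φ' = r cos θ`. -/
structure IsPruferAngle (V : ℝ → ℝ) (μ : ℝ) (θ : ℝ → ℝ) : Prop where
  zero : θ 0 = 0
  hasACDeriv : HasACDeriv θ fun x => 1 + (μ - 1 - V x) * Real.sin (θ x) ^ 2

variable {V : ℝ → ℝ}

theorem intervalIntegrable_const_sub (hV : IntervalIntegrable V volume 0 1) (c : ℝ) :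
    IntervalIntegrable (fun x => c - V x) volume 0 1 :=
  intervalIntegrable_const.sub hV

theorem exists_isPruferAngle (hV : IntervalIntegrable V volume 0 1) (μ : ℝ) :
    ∃ θ, IsPruferAngle V μ θ := by
  obtain ⟨θ, h0, h1⟩ := exists_pruferAngle (intervalIntegrable_const_sub hV (μ - 1))
  exact ⟨θ, h0, h1⟩

theorem intervalIntegrable_divided_difference (hV : IntervalIntegrable V volume 0 1) (c : ℝ)
    {α β : ℝ → ℝ} (hα : ContinuousOn α (uIcc 0 1)) (hβ : ContinuousOn β (uIcc 0 1)) :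
    IntervalIntegrable
      (fun x => (c - V x) * (Real.sinc (α x - β x) * Real.sin (α x + β x))) volume 0 1 := by
  refine (intervalIntegrable_const_sub hV c).mul_continuousOn ?_
  exact (Real.continuous_sinc.comp_continuousOn (hα.sub hβ)).mul
    (Real.continuous_sin.comp_continuousOn (hα.add hβ))

namespace IsPruferAngle

variable {μ ν : ℝ} {θ ϑ : ℝ → ℝ}

theorem continuousOn (h : IsPruferAngle V μ θ) : ContinuousOn θ (uIcc 0 1) :=
  h.hasACDeriv.continuousOn

/-- The difference of the angles solves a linear equation with forcing `(μ - ν) sin² ϑ`. The bound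
on `a` does not involve `ν`, which yields continuity of the endpoint angle at `μ`. -/
theorem apply_one_sub (hV : IntervalIntegrable V volume 0 1) (h : IsPruferAngle V μ θ)
    (h' : IsPruferAngle V ν ϑ) :
    ∃ a : ℝ → ℝ, IntervalIntegrable a volume 0 1 ∧ (∀ x, |a x| ≤ |μ - 1| + |V x|) ∧
      IntervalIntegrable (fun x => (μ - ν) * Real.sin (ϑ x) ^ 2 *
        Real.exp (-∫ s in (0 : ℝ)..x, a s)) volume 0 1 ∧
      (θ 1 - ϑ 1) * Real.exp (-∫ s in (0 : ℝ)..1, a s) = ∫ x in (0 : ℝ)..1,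
        (μ - ν) * Real.sin (ϑ x) ^ 2 * Real.exp (-∫ s in (0 : ℝ)..x, a s) := by
  have ha := intervalIntegrable_divided_difference hV (μ - 1) h.continuousOn h'.continuousOn
  refine ⟨_, ha, fun x => ?_, ?_⟩
  · rw [abs_mul]
    refine (mul_le_of_le_one_right (abs_nonneg _) ?_).trans (abs_sub _ _)
    rw [abs_mul]
    exact mul_le_one₀ (Real.abs_sinc_le_one _) (abs_nonneg _) (Real.abs_sin_le_one _)
  · have hD := (h.hasACDeriv.sub h'.hasACDeriv).congr_deriv' (g₁ := fun x =>
      (μ - 1 - V x) * (Real.sinc (θ x - ϑ x) * Real.sin (θ x + ϑ x)) * (θ x - ϑ x) +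
        (μ - ν) * Real.sin (ϑ x) ^ 2) fun x => by
      linear_combination (μ - 1 - V x) * sin_sq_sub_sin_sq (θ x) (ϑ x)
    have := hD.apply_one_of_linear (D := fun x => θ x - ϑ x) ha
    simpa [h.zero, h'.zero] using this

/-- Otherwise `θ' = 1` almost everywhere, so `θ x = x`, whose sine is positive on `(0,1]`. This
makes monotonicity in `μ` strict and the eigenfunction nonzero. -/
theorem not_ae_sin_eq_zero (h : IsPruferAngle V μ θ) :
    ¬ ∀ᵐ x ∂(volume.restrict (Icc (0 : ℝ) 1)), Real.sin (θ x) = 0 := by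
  intro hs
  have h1 : HasACDeriv θ fun _ => 1 := h.hasACDeriv.congr_deriv <| by
    filter_upwards [hs] with x hx
    simp [hx]
  have h2 : ∀ x ∈ Icc (0 : ℝ) 1, θ x = x := fun x hx => by
    have := h1.integral_eq hx
    simp [h.zero] at this
    linarith
  have h3 : ∀ᵐ x ∂(volume.restrict (Ioc (0 : ℝ) 1)), False := by
    rw [← Measure.restrict_congr_set Ioc_ae_eq_Icc] at hs
    filter_upwards [hs, ae_restrict_mem measurableSet_Ioc] with x hx hx'
    rw [h2 x (Ioc_subset_Icc_self hx')] at hx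
    exact (Real.sin_pos_of_pos_of_le_one hx'.1 hx'.2).ne' hx
  rw [eventually_false_iff_eq_bot, ae_eq_bot, Measure.restrict_eq_zero] at h3
  simp at h3

theorem apply_one_lt (hV : IntervalIntegrable V volume 0 1) (h : IsPruferAngle V μ θ)
    (h' : IsPruferAngle V ν ϑ) (hμν : ν < μ) : ϑ 1 < θ 1 := by
  obtain ⟨a, -, -, hi, h1⟩ := apply_one_sub hV h h'
  have hnn : ∀ x, 0 ≤ (μ - ν) * Real.sin (ϑ x) ^ 2 * Real.exp (-∫ s in (0 : ℝ)..x, a s) :=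
    fun x => by have := sub_pos.2 hμν; positivity
  have hpos : 0 < ∫ x in (0 : ℝ)..1,
      (μ - ν) * Real.sin (ϑ x) ^ 2 * Real.exp (-∫ s in (0 : ℝ)..x, a s) := by
    refine (intervalIntegral.integral_nonneg zero_le_one fun x _ => hnn x).lt_of_ne fun h0 => ?_
    rw [eq_comm, intervalIntegral.integral_eq_zero_iff_of_le_of_nonneg_ae zero_le_one
      (Eventually.of_forall hnn) hi, Measure.restrict_congr_set Ioc_ae_eq_Icc] at h0
    refine h'.not_ae_sin_eq_zero ?_
    filter_upwards [h0] with x hx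
    simpa [sub_eq_zero, hμν.ne', Real.exp_ne_zero] using hx
  rw [← h1] at hpos
  exact sub_pos.1 (pos_of_mul_pos_left hpos (Real.exp_pos _).le)

/-- The factor 2 in the exponent arises because the integrating factor is estimated twice: at the
endpoint and under the integral. -/
theorem abs_apply_one_sub_le (hV : IntervalIntegrable V volume 0 1) (h : IsPruferAngle V μ θ)
    (h' : IsPruferAngle V ν ϑ) :
    |θ 1 - ϑ 1| ≤ Real.exp (2 * (|μ - 1| + ∫ x in (0 : ℝ)..1, |V x|)) * |μ - ν| := by
  obtain ⟨a, ha, hab, hi, h1⟩ := apply_one_sub hV h h'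
  set M := |μ - 1| + ∫ x in (0 : ℝ)..1, |V x| with hM
  have hK : IntervalIntegrable (fun x => |μ - 1| + |V x|) volume 0 1 :=
    intervalIntegrable_const.add hV.abs
  have hA : ∀ x ∈ Icc (0 : ℝ) 1, |∫ s in (0 : ℝ)..x, a s| ≤ M := fun x hx => by
    refine (abs_intervalIntegral_le_of_abs_le hK hab hx).trans_eq ?_
    rw [intervalIntegral.integral_add intervalIntegrable_const hV.abs]
    simp [hM]
  have h2 : |∫ x in (0 : ℝ)..1, (μ - ν) * Real.sin (ϑ x) ^ 2 *
      Real.exp (-∫ s in (0 : ℝ)..x, a s)| ≤ |μ - ν| * Real.exp M * |1 - 0| := by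
    rw [← Real.norm_eq_abs]
    refine intervalIntegral.norm_integral_le_of_norm_le_const fun x hx => ?_
    rw [uIoc_of_le zero_le_one] at hx
    rw [Real.norm_eq_abs, abs_mul, abs_mul, Real.abs_exp]
    refine mul_le_mul ?_ ?_ (Real.exp_pos _).le (abs_nonneg _)
    · refine mul_le_of_le_one_right (abs_nonneg _) ?_
      rw [abs_of_nonneg (sq_nonneg _)]
      exact Real.sin_sq_le_one _
    · exact Real.exp_le_exp.2 (neg_le.1 (abs_le.1 (hA x (Ioc_subset_Icc_self hx))).1)
  have h3 : |θ 1 - ϑ 1| * Real.exp (-M) ≤ |μ - ν| * Real.exp M := by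
    calc |θ 1 - ϑ 1| * Real.exp (-M) ≤ |θ 1 - ϑ 1| * Real.exp (-∫ s in (0 : ℝ)..1, a s) := by
          gcongr
          exact (abs_le.1 (hA 1 (by simp))).2
      _ = |(θ 1 - ϑ 1) * Real.exp (-∫ s in (0 : ℝ)..1, a s)| := by rw [abs_mul, Real.abs_exp]
      _ ≤ _ := by rw [h1]; simpa using h2
  rw [Real.exp_neg, ← div_eq_mul_inv, div_le_iff₀ (Real.exp_pos _)] at h3
  rw [two_mul, Real.exp_add]
  linarith

/-- Comparison with the constant angle 0, for which the forcing term is 1. -/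
theorem apply_one_pos (hV : IntervalIntegrable V volume 0 1) (h : IsPruferAngle V μ θ) :
    0 < θ 1 := by
  have ha := intervalIntegrable_divided_difference hV (μ - 1) h.continuousOn
    (continuousOn_const (c := (0 : ℝ)))
  have hD := h.hasACDeriv.congr_deriv' (g₁ := fun x =>
      (μ - 1 - V x) * (Real.sinc (θ x - 0) * Real.sin (θ x + 0)) * θ x + 1) fun x => by
      have := sin_sq_sub_sin_sq (θ x) 0
      simp only [Real.sin_zero, sub_zero, add_zero] at this ⊢
      linear_combination (μ - 1 - V x) * this
  obtain ⟨hi, h1⟩ := hD.apply_one_of_linear ha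
  rw [h.zero, zero_add] at h1
  have hpos := intervalIntegral.intervalIntegral_pos_of_pos hi
    (fun x => by positivity) zero_lt_one
  rw [← h1] at hpos
  exact pos_of_mul_pos_left hpos (Real.exp_pos _).le

/-- The barrier is the angle `η` with `cot η = w = ∫ V`, coming from the positive supersolution `exp
(∫ w)`. It starts at `π/2`, stays below `π`, and exceeds the right-hand side of the Prüfer equation
by `(-w² - μ) / (1 + w²)`, which is nonnegative since `|w| ≤ ‖V‖₁`. -/
theorem apply_one_lt_pi (hV : IntervalIntegrable V volume 0 1) (h : IsPruferAngle V μ θ)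
    (hμ : μ ≤ -(∫ x in (0 : ℝ)..1, |V x|) ^ 2) : θ 1 < Real.pi := by
  set w : ℝ → ℝ := fun x => ∫ s in (0 : ℝ)..x, V s with hw
  have hη := (HasACDeriv.of_integral hV).comp (F := fun y => Real.pi / 2 - Real.arctan y)
    (F' := fun y => -(1 / (1 + y ^ 2))) (fun y => (Real.hasDerivAt_arctan y).const_sub _)
    (by
      refine (continuous_const.div (by fun_prop) fun y => ?_).neg
      positivity)
  have hsin : ∀ x, Real.sin (Real.pi / 2 - Real.arctan (w x)) ^ 2 = 1 / (1 + w x ^ 2) := fun x => by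
    rw [Real.sin_pi_div_two_sub, Real.cos_sq_arctan]
  have hsub := hη.sub h.hasACDeriv
  have ha := intervalIntegrable_divided_difference hV (μ - 1) hη.continuousOn h.continuousOn
  have hD := hsub.congr_deriv' (g₁ := fun x => (μ - 1 - V x) *
      (Real.sinc (Real.pi / 2 - Real.arctan (w x) - θ x) *
        Real.sin (Real.pi / 2 - Real.arctan (w x) + θ x)) *
        (Real.pi / 2 - Real.arctan (w x) - θ x) + (-w x ^ 2 - μ) / (1 + w x ^ 2)) fun x => by
      have h1 := sin_sq_sub_sin_sq (Real.pi / 2 - Real.arctan (w x)) (θ x)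
      have h2 : (-w x ^ 2 - μ) / (1 + w x ^ 2) = -1 - (μ - 1) * (1 / (1 + w x ^ 2)) := by
        have : 1 + w x ^ 2 ≠ 0 := by positivity
        field_simp; ring
      rw [hsin x] at h1
      rw [h2]
      linear_combination (μ - 1 - V x) * h1
  obtain ⟨-, h1⟩ := hD.apply_one_of_linear (D := fun x => Real.pi / 2 - Real.arctan (w x) - θ x) ha
  have hnn : 0 ≤ ∫ x in (0 : ℝ)..1, (-w x ^ 2 - μ) / (1 + w x ^ 2) *
      Real.exp (-∫ s in (0 : ℝ)..x, (μ - 1 - V s) *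
      (Real.sinc (Real.pi / 2 - Real.arctan (w s) - θ s) *
        Real.sin (Real.pi / 2 - Real.arctan (w s) + θ s))) := by
    refine intervalIntegral.integral_nonneg zero_le_one fun x hx => ?_
    have hwx : w x ^ 2 ≤ (∫ x in (0 : ℝ)..1, |V x|) ^ 2 :=
      sq_le_sq' (abs_le.1 (abs_intervalIntegral_le_of_abs_le hV.abs (fun _ => le_rfl) hx)).1
        (abs_le.1 (abs_intervalIntegral_le_of_abs_le hV.abs (fun _ => le_rfl) hx)).2
    have : 0 ≤ -w x ^ 2 - μ := by linarith
    positivity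
  have h0 : Real.pi / 2 - Real.arctan (w 0) - θ 0 = Real.pi / 2 := by simp [hw, h.zero]
  rw [h0] at h1
  have hpos : 0 < (Real.pi / 2 - Real.arctan (w 1) - θ 1) * Real.exp (-∫ s in (0 : ℝ)..1,
      (μ - 1 - V s) * (Real.sinc (Real.pi / 2 - Real.arctan (w s) - θ s) *
        Real.sin (Real.pi / 2 - Real.arctan (w s) + θ s))) := by
    have := Real.pi_pos
    rw [h1]; linarith
  have := pos_of_mul_pos_left hpos (Real.exp_pos _).le
  have := Real.neg_pi_div_two_lt_arctan (w 1)
  linarith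

end IsPruferAngle

/-! ### The rescaled angle at high energy -/

/-- The change of angle that turns the argument of `(cos y, sin y)` into that of
`(cos y, ρ sin y)`. -/
noncomputable def rescaleAngle (ρ y : ℝ) : ℝ :=
  y + Real.arctan ((ρ - 1) * (Real.sin y * Real.cos y) / (Real.cos y ^ 2 + ρ * Real.sin y ^ 2))

theorem cos_sq_add_mul_sin_sq_pos {ρ : ℝ} (hρ : 0 < ρ) (y : ℝ) :
    0 < Real.cos y ^ 2 + ρ * Real.sin y ^ 2 := by
  rcases eq_or_ne (Real.sin y) 0 with h | h
  · have := Real.sin_sq_add_cos_sq y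
    rw [h] at this ⊢
    nlinarith
  · positivity

/-- The arctangent in `rescaleAngle` is that of the tangent of the difference of the two angles. Its
denominator never vanishes, so no branch of `arctan (ρ tan y)` has to be followed. -/
theorem hasDerivAt_rescaleAngle {ρ : ℝ} (hρ : 0 < ρ) (y : ℝ) :
    HasDerivAt (rescaleAngle ρ) (ρ / (Real.cos y ^ 2 + ρ ^ 2 * Real.sin y ^ 2)) y := by
  have hs := Real.hasDerivAt_sin y
  have hc := Real.hasDerivAt_cos y
  have hM := cos_sq_add_mul_sin_sq_pos hρ y
  have hQ := cos_sq_add_mul_sin_sq_pos (pow_pos hρ 2) y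
  have h := (hasDerivAt_id y).add
    ((((hs.mul hc).const_mul (ρ - 1)).div ((hc.pow 2).add ((hs.pow 2).const_mul ρ)) hM.ne').arctan)
  refine h.congr_deriv ?_
  simp only [Pi.mul_apply, Pi.add_apply, Pi.pow_apply]
  have hcs := Real.cos_sq' y
  have hQ' : (Real.cos y ^ 2 + ρ * Real.sin y ^ 2) ^ 2 + ((ρ - 1) * (Real.sin y * Real.cos y)) ^ 2 =
      Real.cos y ^ 2 + ρ ^ 2 * Real.sin y ^ 2 := by
    rw [mul_pow, mul_pow, hcs]; ring
  have h1 : 1 + ((ρ - 1) * (Real.sin y * Real.cos y) /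
      (Real.cos y ^ 2 + ρ * Real.sin y ^ 2)) ^ 2 =
      (Real.cos y ^ 2 + ρ ^ 2 * Real.sin y ^ 2) / (Real.cos y ^ 2 + ρ * Real.sin y ^ 2) ^ 2 := by
    rw [← hQ']; field_simp
  have hN : (ρ - 1) * (Real.cos y * Real.cos y + Real.sin y * -Real.sin y) *
        (Real.cos y ^ 2 + ρ * Real.sin y ^ 2) - (ρ - 1) * (Real.sin y * Real.cos y) *
        (2 * Real.cos y * -Real.sin y + ρ * (2 * Real.sin y * Real.cos y)) =
      ρ - (Real.cos y ^ 2 + ρ ^ 2 * Real.sin y ^ 2) := by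
    linear_combination ((ρ - 1) * (Real.cos y ^ 2 - ρ * Real.sin y ^ 2) + ρ) * hcs
  simp only [Pi.div_apply, Pi.add_apply, Pi.pow_apply, Nat.cast_ofNat, Nat.add_one_sub_one, pow_one]
  rw [h1, hN]
  field_simp
  ring

theorem rescaleAngle_of_sin_eq_zero {ρ y : ℝ} (h : Real.sin y = 0) : rescaleAngle ρ y = y := by
  simp [rescaleAngle, h]

theorem rescaleAngle_le (ρ y : ℝ) : rescaleAngle ρ y ≤ y + Real.pi / 2 :=
  add_le_add_right (Real.arctan_lt_pi_div_two _).le _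

/-- The rescaled angle has derivative `ρ - ρ V sin² θ / (cos² θ + ρ² sin² θ)`: for `V = 0` the speed
is exactly `ρ`, and the perturbation is at most `|V| / ρ`. -/
theorem IsPruferAngle.abs_rescaleAngle_sub_le {ρ : ℝ} {θ : ℝ → ℝ} (hρ : 0 < ρ)
    (hV : IntervalIntegrable V volume 0 1) (h : IsPruferAngle V (ρ ^ 2) θ) :
    |rescaleAngle ρ (θ 1) - ρ| ≤ (∫ x in (0 : ℝ)..1, |V x|) / ρ := by
  have hQ := cos_sq_add_mul_sin_sq_pos (pow_pos hρ 2)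
  have hF := h.hasACDeriv.comp (hasDerivAt_rescaleAngle hρ)
    (continuous_const.div (by fun_prop) fun y => (hQ y).ne')
  have hlin := HasACDeriv.of_hasDerivWithinAt (f := fun x => ρ * x) (g := fun _ => ρ)
    (fun x _ => by simpa using ((hasDerivAt_id x).const_mul ρ).hasDerivWithinAt) continuousOn_const
  have hD := (hF.sub hlin).congr_deriv' (g₁ := fun x =>
      -(ρ * V x * Real.sin (θ x) ^ 2 / (Real.cos (θ x) ^ 2 + ρ ^ 2 * Real.sin (θ x) ^ 2)))
      fun x => by
    have := (hQ (θ x)).ne'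
    field_simp
    rw [Real.cos_sq']; ring
  have h1 := hD.integral_eq (x := 1) (by simp)
  have h0 : rescaleAngle ρ (θ 0) = 0 := by
    rw [rescaleAngle_of_sin_eq_zero (by simp [h.zero]), h.zero]
  simp only [h0, mul_one, mul_zero, sub_zero] at h1
  rw [← h1, div_eq_mul_inv, ← intervalIntegral.integral_mul_const, ← Real.norm_eq_abs]
  refine intervalIntegral.norm_integral_le_of_norm_le zero_le_one
    (Eventually.of_forall fun x _ => ?_) (hV.abs.mul_const _)
  rw [norm_neg, Real.norm_eq_abs, abs_div, abs_of_pos (hQ _), abs_mul, abs_mul, abs_of_pos hρ,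
    abs_of_nonneg (sq_nonneg (Real.sin (θ x))), div_le_iff₀ (hQ _)]
  have : |V x| * ρ⁻¹ * (Real.cos (θ x) ^ 2 + ρ ^ 2 * Real.sin (θ x) ^ 2) =
      |V x| * ρ⁻¹ * Real.cos (θ x) ^ 2 + ρ * |V x| * Real.sin (θ x) ^ 2 := by
    field_simp
  rw [this]
  have : 0 ≤ |V x| * ρ⁻¹ * Real.cos (θ x) ^ 2 := by positivity
  linarith

/-! ### From angles to eigenfunctions: simplicity of the spectrum -/

namespace IsPruferAngle

variable {μ : ℝ} {θ : ℝ → ℝ}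

/-- The amplitude `r` belonging to the Prüfer angle `θ`. -/
noncomputable def amplitude (V : ℝ → ℝ) (μ : ℝ) (θ : ℝ → ℝ) (x : ℝ) : ℝ :=
  Real.exp (∫ s in (0 : ℝ)..x, (1 + V s - μ) * (Real.sin (θ s) * Real.cos (θ s)))

theorem amplitude_pos (x : ℝ) : 0 < amplitude V μ θ x := Real.exp_pos _

theorem hasACDeriv_amplitude (hV : IntervalIntegrable V volume 0 1) (h : IsPruferAngle V μ θ) :
    HasACDeriv (amplitude V μ θ) fun x => amplitude V μ θ x *
      ((1 + V x - μ) * (Real.sin (θ x) * Real.cos (θ x))) := by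
  refine (HasACDeriv.of_integral ?_).comp (fun y => Real.hasDerivAt_exp y) Real.continuous_exp
  refine ((intervalIntegrable_const.add hV).sub intervalIntegrable_const).mul_continuousOn ?_
  have := h.continuousOn
  fun_prop

theorem hasACDeriv_sin (h : IsPruferAngle V μ θ) : HasACDeriv (fun x => Real.sin (θ x))
    fun x => Real.cos (θ x) * (1 + (μ - 1 - V x) * Real.sin (θ x) ^ 2) :=
  h.hasACDeriv.comp Real.hasDerivAt_sin Real.continuous_cos

theorem hasACDeriv_cos (h : IsPruferAngle V μ θ) : HasACDeriv (fun x => Real.cos (θ x))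
    fun x => -Real.sin (θ x) * (1 + (μ - 1 - V x) * Real.sin (θ x) ^ 2) :=
  h.hasACDeriv.comp Real.hasDerivAt_cos Real.continuous_sin.neg

theorem hasACDeriv_amplitude_mul_sin (hV : IntervalIntegrable V volume 0 1)
    (h : IsPruferAngle V μ θ) : HasACDeriv (fun x => amplitude V μ θ x * Real.sin (θ x))
      fun x => amplitude V μ θ x * Real.cos (θ x) :=
  ((h.hasACDeriv_amplitude hV).mul h.hasACDeriv_sin).congr_deriv' fun x => by ring

theorem hasACDeriv_amplitude_mul_cos (hV : IntervalIntegrable V volume 0 1)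
    (h : IsPruferAngle V μ θ) : HasACDeriv (fun x => amplitude V μ θ x * Real.cos (θ x))
      fun x => (V x - μ) * (amplitude V μ θ x * Real.sin (θ x)) :=
  ((h.hasACDeriv_amplitude hV).mul h.hasACDeriv_cos).congr_deriv' fun x => by
    have := Real.cos_sq' (θ x)
    linear_combination amplitude V μ θ x * Real.sin (θ x) * (1 + V x - μ) * this

/-- The derivative `r cos θ` is continuous, so the fundamental theorem of calculus upgrades
differentiability from almost everywhere to every point, endpoints included. -/
theorem hasDerivWithinAt_amplitude_mul_sin (hV : IntervalIntegrable V volume 0 1)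
    (h : IsPruferAngle V μ θ) {x : ℝ} (hx : x ∈ Icc (0 : ℝ) 1) :
    HasDerivWithinAt (fun x => amplitude V μ θ x * Real.sin (θ x))
      (amplitude V μ θ x * Real.cos (θ x)) (Icc 0 1) x := by
  have hc : ContinuousOn (fun x => amplitude V μ θ x * Real.cos (θ x)) (Icc 0 1) := by
    simpa using (h.hasACDeriv_amplitude_mul_cos hV).continuousOn
  have h1 := h.hasACDeriv_amplitude_mul_sin hV
  have : Fact (x ∈ Icc (0 : ℝ) 1) := ⟨hx⟩
  have h2 := intervalIntegral.integral_hasDerivWithinAt_right (s := Icc (0 : ℝ) 1)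
    (t := Icc (0 : ℝ) 1) (h1.intervalIntegrable.mono_unitInterval hx)
    (hc.stronglyMeasurableAtFilter_nhdsWithin measurableSet_Icc x) (hc x hx)
  refine h2.congr (fun y hy => ?_) ?_
  · rw [h1.integral_eq hy]; simp [h.zero]
  · rw [h1.integral_eq hx]; simp [h.zero]

/-- The solution of the initial value problem with `φ 0 = 0` and `φ' 0 = 1`, cut off outside
`[0,1]`. -/
noncomputable def eigenfunction (V : ℝ → ℝ) (μ : ℝ) (θ : ℝ → ℝ) : ℝ → ℝ :=
  (Icc (0 : ℝ) 1).indicator fun x => amplitude V μ θ x * Real.sin (θ x)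

theorem eigenfunction_mem (hV : IntervalIntegrable V volume 0 1) (h : IsPruferAngle V μ θ)
    (h1 : Real.sin (θ 1) = 0) : eigenfunction V μ θ ∈ dirichletEigenspace V μ := by
  refine ⟨fun x hx => indicator_of_notMem hx _, ?_, ?_, _,
    fun x => (V x - μ) * (amplitude V μ θ x * Real.sin (θ x)), fun x hx => ?_,
    (h.hasACDeriv_amplitude_mul_cos hV).ac, ?_⟩
  · simp [eigenfunction, h.zero]
  · simp [eigenfunction, h1]
  · exact (h.hasDerivWithinAt_amplitude_mul_sin hV hx).congr
      (fun y hy => indicator_of_mem hy _) (indicator_of_mem hx _)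
  · filter_upwards [(h.hasACDeriv_amplitude_mul_cos hV).ae_hasDerivAt,
      ae_restrict_mem measurableSet_Icc] with x hx hx'
    refine ⟨hx, ?_⟩
    rw [eigenfunction, indicator_of_mem hx']
    ring

theorem eigenfunction_ne_zero (h : IsPruferAngle V μ θ) : eigenfunction V μ θ ≠ 0 := by
  intro h0
  refine h.not_ae_sin_eq_zero ?_
  rw [ae_restrict_iff' measurableSet_Icc]
  refine Eventually.of_forall fun x hx => ?_
  have := congrFun h0 x
  rw [eigenfunction, indicator_of_mem hx] at this
  simpa [(amplitude_pos (V := V) (μ := μ) (θ := θ) x).ne'] using this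

theorem exists_eq_smul_eigenfunction (hV : IntervalIntegrable V volume 0 1)
    (h : IsPruferAngle V μ θ) {φ : ℝ → ℝ} (hφ : φ ∈ dirichletEigenspace V μ) :
    ∃ c : ℝ, φ = c • eigenfunction V μ θ := by
  obtain ⟨ho, hz, -, ψ, ψ', hd, hac, hs⟩ := hφ
  have hψ : HasACDeriv ψ fun x => (V x - μ) * φ x := by
    refine ⟨hac, ?_⟩
    filter_upwards [hs] with x hx
    exact hx.1.congr_deriv (by linear_combination -hx.2)
  have hφ' : HasACDeriv φ ψ := HasACDeriv.of_hasDerivWithinAt hd (by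
    simpa using hac.continuousOn)
  have hr : HasACDeriv (fun x => (amplitude V μ θ x)⁻¹) fun x => -(amplitude V μ θ x)⁻¹ *
      ((1 + V x - μ) * (Real.sin (θ x) * Real.cos (θ x))) := by
    have hi : IntervalIntegrable
        (fun x => (1 + V x - μ) * (Real.sin (θ x) * Real.cos (θ x))) volume 0 1 := by
      refine ((intervalIntegrable_const.add hV).sub intervalIntegrable_const).mul_continuousOn ?_
      have := h.continuousOn
      fun_prop
    have := (HasACDeriv.of_integral hi).comp (F := fun y => Real.exp (-y))
      (F' := fun y => -Real.exp (-y)) (fun y => by simpa using (hasDerivAt_neg y).exp)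
      (by fun_prop)
    simpa only [amplitude, ← Real.exp_neg] using this
  -- The Wronskian of `φ` with `r sin θ` is constant and vanishes at 0, so `(φ, φ')` is parallel to
  -- `(sin θ, cos θ)`.
  have hW := ((hφ'.mul (h.hasACDeriv_amplitude_mul_cos hV)).sub
    (hψ.mul (h.hasACDeriv_amplitude_mul_sin hV))).congr_deriv' (g₁ := fun _ => 0)
      fun x => by ring
  -- The component of `(φ, φ')` along `(sin θ, cos θ)`, divided by `r`. Its derivative vanishes by
  -- `hw0`, and its constant value is `ψ 0`.
  have hm := (hr.mul ((hφ'.mul h.hasACDeriv_sin).add (hψ.mul h.hasACDeriv_cos)))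
  have hw0 : ∀ x ∈ Icc (0 : ℝ) 1, φ x * Real.cos (θ x) = ψ x * Real.sin (θ x) := fun x hx => by
    have h1 := hW.eq_of_deriv_eq_zero hx
    simp only [hz, h.zero, Real.sin_zero, zero_mul, mul_zero, sub_zero] at h1
    have h2 : amplitude V μ θ x * (φ x * Real.cos (θ x) - ψ x * Real.sin (θ x)) = 0 := by
      linear_combination h1
    exact sub_eq_zero.1 ((mul_eq_zero.1 h2).resolve_left (amplitude_pos x).ne')
  have hm' := hm.congr_deriv (g₁ := fun _ => 0) (by
    rw [ae_restrict_iff' measurableSet_Icc]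
    refine Eventually.of_forall fun x hx => ?_
    have h1 := hw0 x hx
    have h2 := Real.cos_sq' (θ x)
    linear_combination -(amplitude V μ θ x)⁻¹ * (1 + V x - μ) *
      (Real.sin (θ x) ^ 2 - Real.cos (θ x) ^ 2) * h1 -
      (amplitude V μ θ x)⁻¹ * (1 + V x - μ) * φ x * Real.cos (θ x) * h2)
  refine ⟨ψ 0, funext fun x => ?_⟩
  by_cases hx : x ∈ Icc (0 : ℝ) 1
  · have h1 := hm'.eq_of_deriv_eq_zero hx
    simp only [hz, h.zero, Real.sin_zero, Real.cos_zero, mul_zero, zero_add, mul_one] at h1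
    have h2 : amplitude V μ θ 0 = 1 := by simp [amplitude]
    have h3 := (amplitude_pos (V := V) (μ := μ) (θ := θ) x).ne'
    rw [h2, inv_one, one_mul, inv_mul_eq_iff_eq_mul₀ h3] at h1
    have h4 := Real.cos_sq' (θ x)
    rw [Pi.smul_apply, eigenfunction, indicator_of_mem hx, smul_eq_mul]
    linear_combination Real.sin (θ x) * h1 + Real.cos (θ x) * hw0 x hx - φ x * h4
  · rw [ho x hx, Pi.smul_apply, eigenfunction, indicator_of_notMem hx, smul_zero]

theorem dirichletEigenspace_le (hV : IntervalIntegrable V volume 0 1)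
    (h : IsPruferAngle V μ θ) :
    dirichletEigenspace V μ ≤ Submodule.span ℝ {eigenfunction V μ θ} := fun φ hφ => by
  obtain ⟨c, rfl⟩ := h.exists_eq_smul_eigenfunction hV hφ
  exact Submodule.smul_mem _ _ (Submodule.mem_span_singleton_self _)

theorem dirichletEigenspace_eq_span (hV : IntervalIntegrable V volume 0 1)
    (h : IsPruferAngle V μ θ) (h1 : Real.sin (θ 1) = 0) :
    dirichletEigenspace V μ = Submodule.span ℝ {eigenfunction V μ θ} := by
  refine le_antisymm (h.dirichletEigenspace_le hV) ?_
  rw [Submodule.span_singleton_le_iff_mem]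
  exact h.eigenfunction_mem hV h1

theorem finrank_dirichletEigenspace (hV : IntervalIntegrable V volume 0 1)
    (h : IsPruferAngle V μ θ) (h1 : Real.sin (θ 1) = 0) :
    Module.finrank ℝ (dirichletEigenspace V μ) = 1 := by
  rw [h.dirichletEigenspace_eq_span hV h1, finrank_span_singleton h.eigenfunction_ne_zero]

theorem mem_dirichletEigenvalues_iff (hV : IntervalIntegrable V volume 0 1)
    (h : IsPruferAngle V μ θ) : μ ∈ dirichletEigenvalues V ↔ Real.sin (θ 1) = 0 := by
  constructor
  · intro hμ
    obtain ⟨φ, hφ, hne⟩ := Submodule.exists_mem_ne_zero_of_ne_bot hμ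
    obtain ⟨c, rfl⟩ := h.exists_eq_smul_eigenfunction hV hφ
    have h1 : (c • eigenfunction V μ θ) 1 = 0 := hφ.2.2.1
    have hc : c ≠ 0 := by rintro rfl; simp at hne
    simpa [eigenfunction, hc, (amplitude_pos (V := V) (μ := μ) (θ := θ) 1).ne'] using h1
  · intro h1 h0
    have := h.eigenfunction_mem hV h1
    rw [h0, Submodule.mem_bot] at this
    exact h.eigenfunction_ne_zero this

end IsPruferAngle

theorem finiteDimensional_dirichletEigenspace (hV : IntervalIntegrable V volume 0 1) (μ : ℝ) :
    FiniteDimensional ℝ (dirichletEigenspace V μ) := by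
  obtain ⟨θ, h⟩ := exists_isPruferAngle hV μ
  exact Submodule.finiteDimensional_of_le (h.dirichletEigenspace_le hV)

/-! ### Enumeration and location of the eigenvalues -/

/-- The Dirichlet eigenvalues of a potential `V ∈ L¹` are `n² π² + O(1)`. -/
theorem exists_enumeration_dirichletEigenvalues {V : ℝ → ℝ}
    (hV : IntervalIntegrable V volume 0 1) :
    ∃ (e : ℕ ≃ dirichletEigenvalues V) (C : ℝ),
      (∀ n, Module.finrank ℝ (dirichletEigenspace V (e n)) = 1) ∧
      ∀ n : ℕ, |(e n : ℝ) - Real.pi ^ 2 * ((n : ℝ) + 1) ^ 2| ≤ C := by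
  choose θ hθ using exists_isPruferAngle hV
  set f : ℝ → ℝ := fun μ => θ μ 1 with hf
  set I := ∫ x in (0 : ℝ)..1, |V x| with hI
  have hI0 : 0 ≤ I := intervalIntegral.integral_nonneg zero_le_one fun x _ => abs_nonneg _
  have hmono : StrictMono f := fun ν μ h => (hθ μ).apply_one_lt hV (hθ ν) h
  have hcont : Continuous f := by
    refine continuous_iff_continuousAt.2 fun μ => ?_
    rw [ContinuousAt, tendsto_iff_dist_tendsto_zero]
    refine squeeze_zero (g := fun ν => Real.exp (2 * (|μ - 1| + I)) * |μ - ν|)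
      (fun _ => dist_nonneg) (fun ν => ?_) ?_
    · rw [dist_comm]
      exact (hθ μ).abs_apply_one_sub_le hV (hθ ν)
    · have : Continuous fun ν => Real.exp (2 * (|μ - 1| + I)) * |μ - ν| := by fun_prop
      simpa using this.tendsto μ
  have hscale : ∀ ρ : ℝ, 0 < ρ → |rescaleAngle ρ (f (ρ ^ 2)) - ρ| ≤ I / ρ := fun ρ hρ =>
    (hθ (ρ ^ 2)).abs_rescaleAngle_sub_le hρ hV
  have hpos : ∀ μ, 0 < f μ := fun μ => (hθ μ).apply_one_pos hV
  have hlow : f (-I ^ 2) < Real.pi := (hθ _).apply_one_lt_pi hV le_rfl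
  have hex : ∀ n : ℕ, ∃ μ, f μ = ((n : ℝ) + 1) * Real.pi := fun n => by
    refine mem_range_of_exists_le_of_exists_ge hcont ⟨-I ^ 2, ?_⟩ ?_
    · refine hlow.le.trans ?_
      have : (0 : ℝ) ≤ n := n.cast_nonneg
      nlinarith [Real.pi_pos]
    -- The rescaled angle is at least `ρ - I / ρ ≥ ρ - I` (this uses `ρ ≥ 1`) and exceeds the Prüfer
    -- angle by at most `π/2`; hence `f (ρ²) ≥ (n + 1) π`.
    · set ρ : ℝ := ((n : ℝ) + 1) * Real.pi + I + Real.pi / 2 + 1 with hρ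
      have hN : 0 ≤ ((n : ℝ) + 1) * Real.pi := by positivity
      have hρ1 : 1 ≤ ρ := by have := Real.pi_pos; linarith
      refine ⟨ρ ^ 2, ?_⟩
      have h1 := (abs_le.1 (hscale ρ (by linarith))).1
      have h2 := rescaleAngle_le ρ (f (ρ ^ 2))
      have h3 : I / ρ ≤ I := div_le_self hI0 hρ1
      linarith
  choose m hm using hex
  have hmem : ∀ μ, μ ∈ dirichletEigenvalues V ↔ Real.sin (f μ) = 0 := fun μ =>
    (hθ μ).mem_dirichletEigenvalues_iff hV
  have hsin : ∀ n, Real.sin (f (m n)) = 0 := fun n => by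
    rw [hm]; exact_mod_cast Real.sin_nat_mul_pi (n + 1)
  have hbij : Function.Bijective
      fun n => (⟨m n, (hmem _).2 (hsin n)⟩ : dirichletEigenvalues V) := by
    constructor
    · intro a b hab
      have h1 : m a = m b := congrArg Subtype.val hab
      have h2 := hm a
      rw [h1, hm b] at h2
      have := mul_right_cancel₀ Real.pi_ne_zero h2
      exact_mod_cast (add_right_cancel this).symm
    · rintro ⟨μ, hμ⟩
      obtain ⟨k, hk⟩ := Real.sin_eq_zero_iff.1 ((hmem μ).1 hμ)
      have hk0 : 0 < k := by
        have : 0 < (k : ℝ) := by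
          refine pos_of_mul_pos_left ?_ Real.pi_pos.le
          rw [hk]; exact hpos μ
        exact_mod_cast this
      obtain ⟨n, rfl⟩ : ∃ n : ℕ, k = n + 1 := ⟨(k - 1).toNat, by omega⟩
      refine ⟨n, Subtype.ext (hmono.injective ?_)⟩
      simp only [hm, ← hk]
      push_cast
      ring
  -- The terms `2 I + I²` handle eigenvalues at least 1. Those below 1 lie above `-I²` and have `((n
  -- + 1) π)² ≤ f 1 ^ 2`, so `I² + 1 + f 1 ^ 2` suffices.
  refine ⟨Equiv.ofBijective _ hbij, 2 * I + I ^ 2 + 1 + f 1 ^ 2, fun n => ?_, fun n => ?_⟩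
  · exact (hθ (m n)).finrank_dirichletEigenspace hV (hsin n)
  · change |m n - _| ≤ _
    have hN : 0 < ((n : ℝ) + 1) * Real.pi := by have := Real.pi_pos; positivity
    rcases le_or_gt 1 (m n) with h1 | h1
    · set ρ := Real.sqrt (m n) with hρ
      have hρ1 : 1 ≤ ρ := Real.one_le_sqrt.2 h1
      have hρ2 : ρ ^ 2 = m n := Real.sq_sqrt (by linarith)
      have h2 := hscale ρ (by linarith)
      rw [hρ2, rescaleAngle_of_sin_eq_zero (hsin n), hm n] at h2
      set N := ((n : ℝ) + 1) * Real.pi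
      have h3 : I / ρ ≤ I := div_le_self hI0 hρ1
      -- The decay `I / ρ` is essential: it cancels the factor `ρ` in `N² - ρ² = 2 ρ (N - ρ) + (N -
      -- ρ)²`.
      have h4 : ρ * |N - ρ| ≤ I := by
        rw [le_div_iff₀ (by linarith)] at h2; linarith
      have h5 : |N - ρ| ≤ I := h2.trans h3
      calc |m n - Real.pi ^ 2 * ((n : ℝ) + 1) ^ 2| = |(N - ρ) * (2 * ρ) + (N - ρ) ^ 2| := by
            rw [← abs_neg, ← hρ2]; congr 1; simp only [N]; ring
        _ ≤ |(N - ρ) * (2 * ρ)| + |(N - ρ) ^ 2| := abs_add_le _ _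
        _ = 2 * (ρ * |N - ρ|) + |N - ρ| ^ 2 := by
            rw [abs_mul, abs_pow, abs_of_pos (show 0 < 2 * ρ by linarith)]; ring
        _ ≤ 2 * I + I ^ 2 := by gcongr
        _ ≤ _ := by nlinarith [sq_nonneg (f 1)]
    · have h2 : ((n : ℝ) + 1) * Real.pi < f 1 := by rw [← hm n]; exact hmono h1
      have h3 : -I ^ 2 < m n := by
        rw [← hmono.lt_iff_lt, hm n]
        refine hlow.trans_le ?_
        have : (0 : ℝ) ≤ n := n.cast_nonneg
        nlinarith [Real.pi_pos]
      have h4 : (((n : ℝ) + 1) * Real.pi) ^ 2 ≤ f 1 ^ 2 := by gcongr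
      have h5 : 0 ≤ (((n : ℝ) + 1) * Real.pi) ^ 2 := sq_nonneg _
      rw [abs_le]
      constructor <;> nlinarith

/-! ### Heat trace asymptotics -/

theorem summable_exp_neg_mul_succ_sq {s : ℝ} (hs : 0 < s) :
    Summable fun n : ℕ => Real.exp (-s * ((n : ℝ) + 1) ^ 2) := by
  have h : Summable fun n : ℕ => Real.exp (-s) * Real.exp (-s) ^ n :=
    (summable_geometric_of_lt_one (Real.exp_pos _).le (by simpa using hs)).mul_left _
  refine Summable.of_nonneg_of_le (fun _ => (Real.exp_pos _).le) (fun n => ?_) h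
  rw [← Real.exp_nat_mul, ← Real.exp_add, Real.exp_le_exp]
  have : (0 : ℝ) ≤ n := n.cast_nonneg
  nlinarith [mul_nonneg hs.le (mul_nonneg this (by linarith : (0 : ℝ) ≤ n + 1))]

theorem tsum_int_exp_neg_mul_sq {s : ℝ} (hs : 0 < s) :
    ∑' n : ℤ, Real.exp (-s * (n : ℝ) ^ 2) =
      1 + 2 * ∑' n : ℕ, Real.exp (-s * ((n : ℝ) + 1) ^ 2) := by
  have h := summable_exp_neg_mul_succ_sq hs
  have hp : ∀ n : ℕ, Real.exp (-s * (((n : ℤ) + 1 : ℤ) : ℝ) ^ 2) =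
      Real.exp (-s * ((n : ℝ) + 1) ^ 2) := fun n => by push_cast; rfl
  have hn : ∀ n : ℕ, Real.exp (-s * ((-((n : ℤ) + 1) : ℤ) : ℝ) ^ 2) =
      Real.exp (-s * ((n : ℝ) + 1) ^ 2) := fun n => by push_cast; rw [neg_sq]
  rw [tsum_of_add_one_of_neg_add_one (f := fun n : ℤ => Real.exp (-s * (n : ℝ) ^ 2))
    (h.congr fun n => (hp n).symm) (h.congr fun n => (hn n).symm), tsum_congr hp, tsum_congr hn]
  rw [Int.cast_zero, zero_pow two_ne_zero, mul_zero, Real.exp_zero]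
  ring

theorem abs_exp_sub_one_le_abs_mul_exp (x : ℝ) : |Real.exp x - 1| ≤ |x| * Real.exp |x| := by
  rcases le_total 0 x with h | h
  · rw [abs_of_nonneg h, abs_of_nonneg (by simpa using h)]
    have h1 := mul_le_mul_of_nonneg_right (Real.one_sub_le_exp_neg x) (Real.exp_pos x).le
    rw [← Real.exp_add, neg_add_cancel, Real.exp_zero] at h1
    linarith
  · rw [abs_of_nonpos (by simpa using h)]
    have h1 : -x ≤ |x| := neg_le_abs x
    have h2 : |x| ≤ |x| * Real.exp |x| :=
      le_mul_of_one_le_right (abs_nonneg _) (Real.one_le_exp (abs_nonneg _))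
    linarith [Real.add_one_le_exp x]

/-- The error is relative to `exp (-b)`, so summing over the spectrum gives a multiple of the free
heat trace. -/
theorem abs_exp_neg_sub_exp_neg_le {a b c : ℝ} (h : |a - b| ≤ c) :
    |Real.exp (-a) - Real.exp (-b)| ≤ c * Real.exp c * Real.exp (-b) := by
  have h1 : Real.exp (-a) - Real.exp (-b) = (Real.exp (b - a) - 1) * Real.exp (-b) := by
    rw [sub_mul, ← Real.exp_add]; ring_nf
  rw [h1, abs_mul, Real.abs_exp]
  refine mul_le_mul_of_nonneg_right ?_ (Real.exp_pos _).le
  refine (abs_exp_sub_one_le_abs_mul_exp _).trans ?_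
  rw [abs_sub_comm]
  have : 0 ≤ c := (abs_nonneg _).trans h
  gcongr

theorem div_sqrt_pi_mul_le {t : ℝ} (ht : 0 < t) : t / Real.sqrt (Real.pi * t) ≤ Real.sqrt t := by
  have h : Real.sqrt t ≤ Real.sqrt (Real.pi * t) := by
    refine Real.sqrt_le_sqrt ?_
    nlinarith [Real.pi_gt_three]
  have h0 := Real.sqrt_pos.2 ht
  rw [div_le_iff₀ (h0.trans_le h)]
  calc t = Real.sqrt t * Real.sqrt t := (Real.mul_self_sqrt ht.le).symm
    _ ≤ _ := by gcongr

/-- Small-time asymptotics of the free Dirichlet heat trace. -/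
theorem abs_tsum_exp_neg_sq_sub_le : ∃ K : ℝ, 0 ≤ K ∧ ∀ t : ℝ, 0 < t →
    |∑' n : ℕ, Real.exp (-(t * (Real.pi ^ 2 * ((n : ℝ) + 1) ^ 2))) -
      (1 / (2 * Real.sqrt (Real.pi * t)) - 1 / 2)| ≤ K * Real.sqrt t := by
  have hsum : Summable fun n : ℕ => 1 / ((n : ℝ) + 1) ^ 2 := by
    have := (summable_nat_add_iff 1).2 (Real.summable_one_div_nat_pow.2 one_lt_two)
    simpa using this
  refine ⟨∑' n : ℕ, 1 / ((n : ℝ) + 1) ^ 2, tsum_nonneg fun n => by positivity, fun t ht => ?_⟩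
  have hpt : 0 < Real.pi * t := mul_pos Real.pi_pos ht
  -- Poisson summation reads `1 + 2 S = (1 + 2 R) / √(π t)` with `S`, `R` as below; solving for `S`
  -- produces both explicit terms and the remainder `R / √(π t)`.
  have hP := Real.tsum_exp_neg_mul_int_sq hpt
  have e1 : -Real.pi * (Real.pi * t) = -(Real.pi ^ 2 * t) := by ring
  have e2 : -Real.pi / (Real.pi * t) = -(1 / t) := by
    have := Real.pi_ne_zero
    field_simp
  rw [e1, e2, tsum_int_exp_neg_mul_sq (by positivity), tsum_int_exp_neg_mul_sq (by positivity),
    ← Real.sqrt_eq_rpow] at hP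
  have e3 : ∑' n : ℕ, Real.exp (-(t * (Real.pi ^ 2 * ((n : ℝ) + 1) ^ 2))) =
      ∑' n : ℕ, Real.exp (-(Real.pi ^ 2 * t) * ((n : ℝ) + 1) ^ 2) := by
    congr 1; ext n; ring_nf
  set S := ∑' n : ℕ, Real.exp (-(Real.pi ^ 2 * t) * ((n : ℝ) + 1) ^ 2)
  set R := ∑' n : ℕ, Real.exp (-(1 / t) * ((n : ℝ) + 1) ^ 2) with hR
  have hs := Real.sqrt_pos.2 hpt
  have hR0 : 0 ≤ R := tsum_nonneg fun n => (Real.exp_pos _).le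
  -- `R` is exponentially small, but the crude bound `exp (-x) ≤ 1 / x` already gives `R = O(t)`,
  -- which is enough.
  have hRK : R ≤ t * ∑' n : ℕ, 1 / ((n : ℝ) + 1) ^ 2 := by
    rw [← tsum_mul_left]
    refine (summable_exp_neg_mul_succ_sq (by positivity)).tsum_le_tsum (fun n => ?_)
      (hsum.mul_left t)
    have hx : 0 < 1 / t * ((n : ℝ) + 1) ^ 2 := by positivity
    rw [neg_mul, Real.exp_neg]
    calc (Real.exp (1 / t * ((n : ℝ) + 1) ^ 2))⁻¹ ≤ (1 / t * ((n : ℝ) + 1) ^ 2)⁻¹ := by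
          gcongr
          linarith [Real.add_one_le_exp (1 / t * ((n : ℝ) + 1) ^ 2)]
      _ = t * (1 / ((n : ℝ) + 1) ^ 2) := by field_simp
  have e4 : S - (1 / (2 * Real.sqrt (Real.pi * t)) - 1 / 2) = R / Real.sqrt (Real.pi * t) := by
    field_simp at hP ⊢
    linarith
  rw [e3, e4, abs_of_nonneg (by positivity)]
  calc R / Real.sqrt (Real.pi * t) ≤ (t * ∑' n : ℕ, 1 / ((n : ℝ) + 1) ^ 2) /
        Real.sqrt (Real.pi * t) := by gcongr
    _ = (∑' n : ℕ, 1 / ((n : ℝ) + 1) ^ 2) * (t / Real.sqrt (Real.pi * t)) := by ring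
    _ ≤ _ := mul_le_mul_of_nonneg_left (div_sqrt_pi_mul_le ht)
        (tsum_nonneg fun n => by positivity)

theorem mainTheorem6 (q : ℝ≥0∞) (hq : 1 ≤ q) (V : ℝ → ℝ)
    (hV : MemLp V q (volume.restrict (Icc (0 : ℝ) 1))) :
    (∀ μ : ℝ, FiniteDimensional ℝ (dirichletEigenspace V μ)) ∧
    (∀ t : ℝ, 0 < t → Summable (heatTerm V t)) ∧
    (fun t : ℝ => heatTrace V t - (1 / (2 * Real.sqrt (Real.pi * t)) - 1 / 2))
      =O[𝓝[>] 0] (fun t : ℝ => Real.sqrt t) := by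
  -- On a finite measure space `L^q ⊆ L¹`; integrability is all that is needed from here on.
  have hV1 : IntervalIntegrable V volume 0 1 := by
    rw [intervalIntegrable_iff_integrableOn_Icc_of_le zero_le_one]
    exact hV.integrable hq
  obtain ⟨e, C, hfin, hC⟩ := exists_enumeration_dirichletEigenvalues hV1
  obtain ⟨K, hK0, hK⟩ := abs_tsum_exp_neg_sq_sub_le
  have hC0 : 0 ≤ C := (abs_nonneg _).trans (hC 0)
  have hterm : ∀ t n, heatTerm V t (e n) = Real.exp (-(t * e n)) := fun t n => by
    rw [heatTerm, hfin n]; simp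
  have hfree : ∀ t : ℝ, 0 < t →
      Summable fun n : ℕ => Real.exp (-(t * (Real.pi ^ 2 * ((n : ℝ) + 1) ^ 2))) := fun t ht => by
    have := summable_exp_neg_mul_succ_sq (s := t * Real.pi ^ 2) (by positivity)
    refine this.congr fun n => ?_
    ring_nf
  have hdiff : ∀ t : ℝ, 0 < t → ∀ n : ℕ, |Real.exp (-(t * e n)) -
      Real.exp (-(t * (Real.pi ^ 2 * ((n : ℝ) + 1) ^ 2)))| ≤
      t * C * Real.exp (t * C) * Real.exp (-(t * (Real.pi ^ 2 * ((n : ℝ) + 1) ^ 2))) :=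
    fun t ht n => by
      refine abs_exp_neg_sub_exp_neg_le ?_
      rw [← mul_sub, abs_mul, abs_of_pos ht]
      exact mul_le_mul_of_nonneg_left (hC n) ht.le
  have hsd : ∀ t : ℝ, 0 < t → Summable fun n : ℕ => Real.exp (-(t * e n)) -
      Real.exp (-(t * (Real.pi ^ 2 * ((n : ℝ) + 1) ^ 2))) := fun t ht =>
    Summable.of_norm_bounded ((hfree t ht).mul_left _) (hdiff t ht)
  have hsum : ∀ t : ℝ, 0 < t → Summable fun n : ℕ => Real.exp (-(t * e n)) := fun t ht => by
    simpa using (hsd t ht).add (hfree t ht)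
  refine ⟨finiteDimensional_dirichletEigenspace hV1, fun t ht => ?_, ?_⟩
  · rw [← e.summable_iff]
    exact (hsum t ht).congr fun n => (hterm t n).symm
  · refine IsBigO.of_bound (C * Real.exp C * (1 + K) + K) ?_
    filter_upwards [Ioc_mem_nhdsGT (zero_lt_one' ℝ)] with t ⟨ht, ht1⟩
    have htr : heatTrace V t = ∑' n : ℕ, Real.exp (-(t * e n)) := by
      rw [heatTrace, ← e.tsum_eq]
      exact tsum_congr (hterm t)
    set S := ∑' n : ℕ, Real.exp (-(t * (Real.pi ^ 2 * ((n : ℝ) + 1) ^ 2))) with hS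
    have hS0 : 0 ≤ S := tsum_nonneg fun n => (Real.exp_pos _).le
    have h1 : |heatTrace V t - S| ≤ t * C * Real.exp (t * C) * S := by
      rw [htr, hS, ← (hsum t ht).tsum_sub (hfree t ht), ← tsum_mul_left]
      exact tsum_of_norm_bounded (f := fun n : ℕ => Real.exp (-(t * e n)) -
        Real.exp (-(t * (Real.pi ^ 2 * ((n : ℝ) + 1) ^ 2))))
        ((hfree t ht).mul_left (t * C * Real.exp (t * C))).hasSum (hdiff t ht)
    have h2 := hK t ht
    have hst : 0 < Real.sqrt t := Real.sqrt_pos.2 ht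
    -- The free trace is `O(1/√t)`, so the relative error `O(t)` costs only `O(√t)`.
    have h3 : t * S ≤ (1 + K) * Real.sqrt t := by
      have h4 := (abs_le.1 h2).2
      have h5 : S ≤ 1 / Real.sqrt (Real.pi * t) + K * Real.sqrt t := by
        have : 0 ≤ 1 / (2 * Real.sqrt (Real.pi * t)) := by positivity
        have h6 : 1 / Real.sqrt (Real.pi * t) = 2 * (1 / (2 * Real.sqrt (Real.pi * t))) := by
          field_simp
        linarith
      calc t * S ≤ t * (1 / Real.sqrt (Real.pi * t) + K * Real.sqrt t) := by gcongr
        _ = t / Real.sqrt (Real.pi * t) + t * (K * Real.sqrt t) := by ring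
        _ ≤ Real.sqrt t + 1 * (K * Real.sqrt t) := by
            gcongr
            exact div_sqrt_pi_mul_le ht
        _ = _ := by ring
    have h7 : t * C * Real.exp (t * C) * S ≤ C * Real.exp C * (1 + K) * Real.sqrt t := by
      calc t * C * Real.exp (t * C) * S = C * Real.exp (t * C) * (t * S) := by ring
        _ ≤ C * Real.exp C * ((1 + K) * Real.sqrt t) := by
            gcongr
            exact mul_le_of_le_one_left hC0 ht1
        _ = _ := by ring
    rw [Real.norm_eq_abs, Real.norm_eq_abs, abs_of_pos hst]
    refine (abs_sub_le _ S _).trans ?_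
    linarith
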